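/- Let $N\ge 2$ and $\mathcal I_N=\{0,\dots,N-1\}$. **Systems of maps.** A compatible system on $[0,1]$ is a family $(h_i)_{i\in\mathcal I_N}$ of strictly increasing continuous maps $[0,1]\to[0,1]$ with $h_0(0)=0$, $h_{i-1}(1)=h_i(0)$ for $1\le i\le N-1$, and $h_{N-1}(1)=1$. It is a contractive system if moreover $\mathrm{Lip}(h_i):=\sup_{x\ne y}\frac{|h_i(x)-h_i(y)|}{|x-y|}<1$ for every $i$. An LF system is a family $g_i(x)=\frac{a_ix+b_i}{c_ix+d_i}$, $x\in[0,1]$, $i\in\mathcal I_N$, with real coefficients such that, for every $i\in\mathcal I_N$, $d_i>0$, $c_i+d_i>0$ and $0<a_id_i-b_ic_i\le\min\{d_i^2,(c_i+d_i)^2\}$, and such that $b_0=0$ and $\frac{a_i+b_i}{c_i+d_i}=\frac{b_{i+1}}{d_{i+1}}$ for every $i\in\mathcal I_N$, where $\frac{b_N}{d_N}:=1$. The maps $g_i$ do not change when $a_i,b_i,c_i,d_i$ are multiplied by a common positive constant; in the following definitions the coefficients are normalized so that $d_i=1$ for all $i$, and $b_N:=1$. **The vectors $\mathfrak p_i$.**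 Let $y_0:=\frac{c_0}{1-a_0}$, read as $+\infty$ if $a_0=1$, and $y_i:=\frac{a_i-1+\sqrt{(1-a_i)^2+4b_ic_i}}{2b_i}$ for $1\le i\le N-1$. Let $\alpha:=\min\{0,y_0,\dots,y_{N-1}\}$, $\beta:=\max\{0,y_0,\dots,y_{N-1}\}$ and $Y:=[\alpha,\beta]\subset[-1,+\infty]$. For $y\in Y$ let $$H_i(y):=\frac{a_iy+c_i}{b_iy+1},\qquad G_i(y):=\frac{(b_{i+1}-b_i)(y+1)}{(b_{i+1}y+1)(b_iy+1)},$$ where the values at $y=+\infty$, and the value of $G_{N-1}$ at $y=-1$ (which is $1$), are defined as limits. Then $y_i$ is the unique fixed point of $H_i$ in $Y$. Let $\mathfrak p_i:=(G_0(y_i),\dots,G_{N-1}(y_i))$, $i\in\mathcal I_N$. **Theorem.** Let $(g_i)_{i\in\mathcal I_N}$ be an LF system with $\mathfrak p_0=\mathfrak p_1=\dots=\mathfrak p_{N-1}$. Then for every $\epsilon\in(0,1/2)$ there is $\delta>0$ with the following property. Let $(f_i)_{i\in\mathcal I_N}$ be any contractive system on $[0,1]$ whose Lipschitz constants $r_i:=\mathrm{Lip}(f_i)$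 satisfy $$\epsilon\le r_i\le 1-\epsilon\ \ (i\in\mathcal I_N),\qquad \sum_{i\in\mathcal I_N}r_i<1+\delta,\qquad \sum_{i\in\mathcal I_N}\bigl|r_i-(\mathfrak p_0)_i\bigr|\ge\epsilon ,$$ and let $\varphi:[0,1]\to[0,1]$ be the continuous strictly increasing solution of $g_i\circ\varphi=\varphi\circ f_i$, $i\in\mathcal I_N$. Let $\mu_\varphi$ be the Borel probability measure on $[0,1]$ with distribution function $\varphi$. Then $$\dim_H\mu_\varphi:=\inf\{\dim_HA:\ A\subset[0,1]\text{ Borel},\ \mu_\varphi(A)=1\}<1 .$$ -/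

import Mathlib

namespace ConjugateEq

noncomputable section

/-! ### Systems of maps on the unit interval, contractions -/

/-- A compatible system of `N` maps on `[0,1]`: strictly increasing continuous maps with
`h_0(0) = 0`, `h_{i-1}(1) = h_i(0)` and `h_{N-1}(1) = 1`. -/
structure IsCompatibleSystem {N : ℕ} (h : Fin N → unitInterval → unitInterval) : Prop where
  strictMono : ∀ i, StrictMono (h i)
  continuous : ∀ i, Continuous (h i)
  first : ∀ i : Fin N, (i : ℕ) = 0 → h i 0 = 0
  glue : ∀ i j : Fin N, (i : ℕ) + 1 = j → h i 1 = h j 0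
  last : ∀ i : Fin N, (i : ℕ) + 1 = N → h i 1 = 1

/-- `sup_{x ≠ y} |h(x) - h(y)| / |x - y|`, as an extended nonnegative number. -/
def elip (h : unitInterval → unitInterval) : ENNReal :=
  ⨆ (x : unitInterval) (y : unitInterval) (_ : x ≠ y),
    ENNReal.ofReal (|(h x : ℝ) - (h y : ℝ)| / |(x : ℝ) - (y : ℝ)|)

/-- A contraction on `[0,1]`: the Lipschitz constant is (finite and) less than `1`. -/
def IsContraction (h : unitInterval → unitInterval) : Prop := elip h < 1

/-- The Lipschitz constant as a real number (used for contractions, where `elip h` is finite). -/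
def lip (h : unitInterval → unitInterval) : ℝ := (elip h).toReal

/-- A contractive system on `[0,1]`: a compatible system of contractions. -/
structure IsContractiveSystem {N : ℕ} (h : Fin N → unitInterval → unitInterval) : Prop
    extends IsCompatibleSystem h where
  contraction : ∀ i, IsContraction (h i)

/-! ### Linear fractional systems -/

/-- The coefficients of an LF system `g_i(x) = (a_i x + b_i) / (c_i x + d_i)`, `0 ≤ i < N`. -/
structure LFSystem (N : ℕ) where
  a : Fin N → ℝ
  b : Fin N → ℝ
  c : Fin N → ℝ
  d : Fin N → ℝ
  cd_pos : ∀ i, 0 < c i + d i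
  d_pos : ∀ i, 0 < d i
  det_pos : ∀ i, 0 < a i * d i - b i * c i
  det_le : ∀ i, a i * d i - b i * c i ≤ min (d i ^ 2) ((c i + d i) ^ 2)
  first : ∀ i : Fin N, (i : ℕ) = 0 → b i = 0
  glue : ∀ i j : Fin N, (i : ℕ) + 1 = j → (a i + b i) / (c i + d i) = b j / d j
  last : ∀ i : Fin N, (i : ℕ) + 1 = N → (a i + b i) / (c i + d i) = 1

namespace LFSystem

variable {N : ℕ} (S : LFSystem N)

/-- The map `g_i`. -/
def g (i : Fin N) (x : ℝ) : ℝ := (S.a i * x + S.b i) / (S.c i * x + S.d i)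

/-- The coefficient `a_i` after normalizing `d_i = 1`. -/
def A (i : Fin N) : ℝ := S.a i / S.d i

/-- The coefficient `b_i` after normalizing `d_i = 1`. -/
def B (i : Fin N) : ℝ := S.b i / S.d i

/-- The coefficient `c_i` after normalizing `d_i = 1`. -/
def C (i : Fin N) : ℝ := S.c i / S.d i

/-- The points `c_0 / (1 - a_0)` (read as `+∞` if `a_0 = 1`) and
`(a_i - 1 + √((1 - a_i)² + 4 b_i c_i)) / (2 b_i)`, `i ≥ 1`, for the normalized coefficients.
They are the fixed points of the maps `H_i` below, see `fixedPoints_eq`. -/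
def fixPt (i : Fin N) : EReal :=
  if (i : ℕ) = 0 then
    if S.A i = 1 then ⊤ else ((S.C i / (1 - S.A i) : ℝ) : EReal)
  else
    (((S.A i - 1 + Real.sqrt ((1 - S.A i) ^ 2 + 4 * S.B i * S.C i)) / (2 * S.B i) : ℝ) : EReal)

/-- `α`, the least of `0` and the points `fixPt i`; a value `+∞` has no influence here. -/
def α : EReal := min 0 (⨅ i, S.fixPt i)

/-- `β`, the largest of `0` and the points `fixPt i`; possibly `+∞`. -/
def β : EReal := max 0 (⨆ i, S.fixPt i)

/-- The compact interval `Y = [α, β] ⊆ [-1, +∞]`. -/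
def Y : Set EReal := Set.Icc S.α S.β

/-- `H_i(y) = (a_i y + c_i) / (b_i y + 1)` (normalized coefficients), with the limit values
at `y = +∞`. Only the values on `Y` matter. -/
def H (i : Fin N) (y : EReal) : EReal :=
  if y = ⊤ then
    if (i : ℕ) = 0 then ⊤ else ((S.A i / S.B i : ℝ) : EReal)
  else (((S.A i * y.toReal + S.C i) / (S.B i * y.toReal + 1) : ℝ) : EReal)

/-- `G_i(y) = (b_{i+1} - b_i)(y + 1) / ((b_{i+1} y + 1)(b_i y + 1))`, where
`b_i = g_i(0)` and `b_{i+1} = g_i(1)`. The values at `y = +∞` are the limits there. At `y = -1` the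
formula for the last index `i = N - 1` (where `b_N = 1`) has a removable singularity with
limit `1`, and for the other indices it gives `0`. Only the values on `Y` matter. -/
def G (i : Fin N) (y : EReal) : ℝ :=
  if y = ⊤ then (if (i : ℕ) = 0 then 1 else 0)
  else if y = ((-1 : ℝ) : EReal) then (if (i : ℕ) + 1 = N then 1 else 0)
  else ((S.g i 1 - S.g i 0) * (y.toReal + 1)) /
    ((S.g i 1 * y.toReal + 1) * (S.g i 0 * y.toReal + 1))

/-- The vector `𝔭_i = (G_k(y))_k`, where `y` is the unique fixed point of `H_i` in `Y`. -/
def p (i : Fin N) : Fin N → ℝ := fun k => S.G k (S.fixPt i)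

/-! The fixed point of `H_i` in `Y` is unique and equals `fixPt i`. -/

lemma B_eq (i : Fin N) : S.B i = S.g i 0 := by simp [B, g]

lemma one_add_C_pos (i : Fin N) : 0 < 1 + S.C i := by
  have h := S.cd_pos i
  have hd := S.d_pos i
  have e : 1 + S.C i = (S.c i + S.d i) / S.d i := by unfold C; field_simp; ring
  rw [e]; positivity

lemma g_one (i : Fin N) : S.g i 1 = (S.A i + S.B i) / (1 + S.C i) := by
  have hd := S.d_pos i
  have h := S.cd_pos i
  have h2 : S.d i + S.c i ≠ 0 := by linarith
  unfold g A B C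
  field_simp
  ring

lemma g_one_mul (i : Fin N) : S.A i + S.B i = S.g i 1 * (1 + S.C i) := by
  rw [S.g_one, div_mul_cancel₀ _ (S.one_add_C_pos i).ne']

lemma det_eq (i : Fin N) :
    S.A i - S.B i * S.C i = (S.a i * S.d i - S.b i * S.c i) / S.d i ^ 2 := by
  have hd := S.d_pos i
  unfold A B C; field_simp

lemma ndet_pos (i : Fin N) : 0 < S.A i - S.B i * S.C i := by
  rw [S.det_eq]
  exact div_pos (S.det_pos i) (pow_pos (S.d_pos i) 2)

lemma ndet_le_one (i : Fin N) : S.A i - S.B i * S.C i ≤ 1 := by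
  rw [S.det_eq, div_le_one (pow_pos (S.d_pos i) 2)]
  exact (S.det_le i).trans (min_le_left _ _)

lemma ndet_le (i : Fin N) : S.A i - S.B i * S.C i ≤ (1 + S.C i) ^ 2 := by
  have hd := S.d_pos i
  have e : (1 + S.C i) ^ 2 = (S.c i + S.d i) ^ 2 / S.d i ^ 2 := by
    unfold C; field_simp; ring
  rw [S.det_eq, e]
  exact div_le_div_of_nonneg_right ((S.det_le i).trans (min_le_right _ _)) (by positivity)

lemma g_zero_lt_g_one (i : Fin N) : S.g i 0 < S.g i 1 := by
  rw [← S.B_eq, S.g_one, lt_div_iff₀ (S.one_add_C_pos i)]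
  have := S.ndet_pos i
  nlinarith

lemma B_first (i : Fin N) (hi : (i : ℕ) = 0) : S.B i = 0 := by simp [B, S.first i hi]

lemma g_glue (i j : Fin N) (h : (i : ℕ) + 1 = j) : S.g i 1 = S.g j 0 := by
  simpa [g] using S.glue i j h

lemma g_last (i : Fin N) (h : (i : ℕ) + 1 = N) : S.g i 1 = 1 := by
  simpa [g] using S.last i h

lemma B_nonneg_aux (n : ℕ) (hn : n < N) : 0 ≤ S.B ⟨n, hn⟩ ∧ (n ≠ 0 → 0 < S.B ⟨n, hn⟩) := by
  induction n with
  | zero => simp [S.B_first ⟨0, hn⟩ rfl]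
  | succ k ih =>
    have h0 := (ih (by omega)).1
    have h1 := S.g_zero_lt_g_one ⟨k, by omega⟩
    rw [S.g_glue ⟨k, by omega⟩ ⟨k + 1, hn⟩ rfl, ← S.B_eq, ← S.B_eq] at h1
    exact ⟨by linarith, fun _ => by linarith⟩

lemma B_nonneg (i : Fin N) : 0 ≤ S.B i := (S.B_nonneg_aux i i.2).1

lemma B_pos (i : Fin N) (hi : (i : ℕ) ≠ 0) : 0 < S.B i := (S.B_nonneg_aux i i.2).2 hi

lemma g_one_le_aux (m : ℕ) : ∀ i : Fin N, (i : ℕ) + 1 + m = N →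
    S.g i 1 ≤ 1 ∧ (m ≠ 0 → S.g i 1 < 1) := by
  induction m with
  | zero => intro i hi; simp [S.g_last i (by omega)]
  | succ k ih =>
    intro i hi
    have h0 := (ih ⟨i + 1, by omega⟩ (by simp; omega)).1
    have h1 := S.g_zero_lt_g_one ⟨i + 1, by omega⟩
    rw [← S.g_glue i ⟨i + 1, by omega⟩ rfl] at h1
    exact ⟨by linarith, fun _ => by linarith⟩

lemma g_one_le (i : Fin N) : S.g i 1 ≤ 1 :=
  (S.g_one_le_aux (N - (i + 1)) i (by omega)).1

lemma g_one_lt (i : Fin N) (hi : (i : ℕ) + 1 ≠ N) : S.g i 1 < 1 :=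
  (S.g_one_le_aux (N - (i + 1)) i (by omega)).2 (by omega)

lemma B_lt_one (i : Fin N) : S.B i < 1 := by
  rw [S.B_eq]; exact (S.g_zero_lt_g_one i).trans_le (S.g_one_le i)

lemma quad_neg_one (i : Fin N) : S.A i + S.B i ≤ 1 + S.C i := by
  rw [S.g_one_mul]
  have := S.g_one_le i
  have := S.one_add_C_pos i
  nlinarith

lemma quad_neg_one_lt (i : Fin N) (hi : (i : ℕ) + 1 ≠ N) : S.A i + S.B i < 1 + S.C i := by
  rw [S.g_one_mul]
  have := S.g_one_lt i hi
  have := S.one_add_C_pos i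
  nlinarith

lemma quad_neg_one_last (i : Fin N) (hi : (i : ℕ) + 1 = N) : S.A i + S.B i = 1 + S.C i := by
  rw [S.g_one_mul, S.g_last i hi, one_mul]

/-- The larger root of `b y² + (1 - a) y - c` is real and at least `-1`, and a root `y ≥ -1` is
the larger root unless it is `-1` and the larger root is bigger. -/
lemma root_aux {a b c : ℝ} (hb : 0 < b) (h : a + b ≤ 1 + c) :
    let r := (a - 1 + Real.sqrt ((1 - a) ^ 2 + 4 * b * c)) / (2 * b)
    b * r ^ 2 + (1 - a) * r - c = 0 ∧ (-1 : ℝ) ≤ r ∧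
      (a + b < 1 + c → -1 < r) ∧
      ∀ y : ℝ, -1 ≤ y → b * y ^ 2 + (1 - a) * y - c = 0 → y = r ∨ (y = -1 ∧ -1 < r) := by
  intro r
  have hD : 0 ≤ (1 - a) ^ 2 + 4 * b * c := by
    nlinarith [sq_nonneg (1 - a - 2 * b)]
  set s := Real.sqrt ((1 - a) ^ 2 + 4 * b * c) with hs
  have hs0 : 0 ≤ s := Real.sqrt_nonneg _
  have hs2 : s ^ 2 = (1 - a) ^ 2 + 4 * b * c := Real.sq_sqrt hD
  have hr : 2 * b * r = a - 1 + s := by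
    change 2 * b * ((a - 1 + s) / (2 * b)) = _
    field_simp
  have hfac : ∀ y : ℝ, b * y ^ 2 + (1 - a) * y - c
      = (y - r) * (b * y + b * r + 1 - a) := by
    intro y
    have hq : b * r ^ 2 + (1 - a) * r - c = 0 := by
      have : 4 * b * (b * r ^ 2 + (1 - a) * r - c) = 0 := by
        have e : 4 * b * (b * r ^ 2 + (1 - a) * r - c)
          = (2 * b * r) ^ 2 + 2 * (1 - a) * (2 * b * r) - 4 * b * c := by ring
        rw [e, hr]; nlinarith
      rcases mul_eq_zero.1 this with h1 | h1
      · linarith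
      · exact h1
    linear_combination hq
  have hge : (-1 : ℝ) ≤ r := by
    by_contra hlt
    push Not at hlt
    have h1 := hfac (-1)
    have h2 : 0 < (-1 - r) * (b * (-1) + b * r + 1 - a) ∨ b * (-1) + b * r + 1 - a ≤ 0 := by
      by_cases h3 : b * (-1) + b * r + 1 - a ≤ 0
      · exact Or.inr h3
      · left; push Not at h3; exact mul_pos (by linarith) h3
    rcases h2 with h2 | h2
    · nlinarith
    · nlinarith
  have hgt : a + b < 1 + c → -1 < r := by
    intro h'
    rcases hge.lt_or_eq with h1 | h1
    · exact h1
    · have h2 := hfac (-1)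
      rw [← h1] at h2
      nlinarith
  refine ⟨by rw [hfac]; ring, hge, hgt, ?_⟩
  intro y hy hq
  rw [hfac] at hq
  rcases mul_eq_zero.1 hq with h1 | h1
  · left; linarith
  · by_cases hyr : y = r
    · exact Or.inl hyr
    right
    have hlt : y < r := by
      rcases lt_or_gt_of_ne hyr with h2 | h2
      · exact h2
      · nlinarith
    have hy1 : y = -1 := by
      rcases hy.lt_or_eq with h2 | h2
      · have h3 := hfac (-1)
        have h4 : (-1 - r) * (b * (-1) + b * r + 1 - a) = (-1 - r) * (b * (-1 - y)) := by
          rw [show b * (-1) + b * r + 1 - a = b * (-1 - y) by linarith]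
        rw [h4] at h3
        have : 0 < (-1 - r) * (b * (-1 - y)) :=
          mul_pos_of_neg_of_neg (by linarith) (mul_neg_of_pos_of_neg hb (by linarith))
        nlinarith
      · exact h2.symm
    exact ⟨hy1, hy1 ▸ hlt⟩

lemma fixPt_zero (i : Fin N) (hi : (i : ℕ) = 0) (hA : S.A i ≠ 1) :
    S.fixPt i = ((S.C i / (1 - S.A i) : ℝ) : EReal) := by simp [fixPt, hi, hA]

lemma A_first_lt (i : Fin N) (hi : (i : ℕ) = 0) (hA : S.A i ≠ 1) : S.A i < 1 := by
  have h := S.ndet_le_one i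
  rw [S.B_first i hi] at h
  exact lt_of_le_of_ne (by linarith) hA

lemma neg_one_lt_fixPt (i : Fin N) (hi : (i : ℕ) + 1 ≠ N) : ((-1 : ℝ) : EReal) < S.fixPt i := by
  have h1 := S.quad_neg_one_lt i hi
  by_cases h0 : (i : ℕ) = 0
  · by_cases hA : S.A i = 1
    · simp only [fixPt, h0, hA, if_true]; exact EReal.coe_lt_top _
    · rw [S.fixPt_zero i h0 hA]
      have hA' := S.A_first_lt i h0 hA
      rw [S.B_first i h0] at h1
      have : (-1 : ℝ) < S.C i / (1 - S.A i) := by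
        rw [lt_div_iff₀ (by linarith)]; linarith
      exact_mod_cast this
  · have h2 := (root_aux (S.B_pos i h0) h1.le).2.2.1 h1
    rw [fixPt, if_neg h0]
    exact_mod_cast h2

lemma neg_one_le_fixPt (hN : 2 ≤ N) (i : Fin N) : ((-1 : ℝ) : EReal) ≤ S.fixPt i := by
  by_cases hi : (i : ℕ) + 1 = N
  · have h0 : (i : ℕ) ≠ 0 := by omega
    have h2 := (root_aux (S.B_pos i h0) (S.quad_neg_one i)).2.1
    rw [fixPt, if_neg h0]
    exact_mod_cast h2
  · exact (S.neg_one_lt_fixPt i hi).le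

lemma neg_one_le_of_mem (hN : 2 ≤ N) {y : EReal} (hy : y ∈ S.Y) : ((-1 : ℝ) : EReal) ≤ y := by
  refine le_trans (le_min ?_ (le_iInf (S.neg_one_le_fixPt hN))) hy.1
  exact_mod_cast (by norm_num : (-1 : ℝ) ≤ 0)

lemma fixPt_mem (i : Fin N) : S.fixPt i ∈ S.Y :=
  ⟨(min_le_right _ _).trans (iInf_le _ i), (le_iSup S.fixPt i).trans (le_max_right _ _)⟩

lemma α_gt (hN : 2 ≤ N) (h : ∀ i : Fin N, (i : ℕ) + 1 = N → ((-1 : ℝ) : EReal) < S.fixPt i) :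
    ((-1 : ℝ) : EReal) < S.α := by
  have : Nonempty (Fin N) := ⟨⟨0, by omega⟩⟩
  obtain ⟨j, hj⟩ := exists_eq_ciInf_of_finite (f := S.fixPt)
  refine lt_min ?_ ?_
  · exact_mod_cast (by norm_num : (-1 : ℝ) < 0)
  · rw [← hj]
    by_cases hi : (j : ℕ) + 1 = N
    · exact h j hi
    · exact S.neg_one_lt_fixPt j hi

/-- `H_i` has exactly one fixed point in `Y`, namely `fixPt i`. -/
theorem fixedPoints_eq (hN : 2 ≤ N) (i : Fin N) :
    {y | y ∈ S.Y ∧ S.H i y = y} = {S.fixPt i} := by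
  ext y
  simp only [Set.mem_ofPred_eq, Set.mem_singleton_iff]
  -- the equation on real points
  have hreal : ∀ x : ℝ, -1 ≤ x →
      (S.H i (x : EReal) = x ↔ S.B i * x ^ 2 + (1 - S.A i) * x - S.C i = 0) := by
    intro x hx
    have hB := S.B_nonneg i
    have hB1 := S.B_lt_one i
    have hpos : 0 < S.B i * x + 1 := by nlinarith
    rw [H, if_neg (EReal.coe_ne_top x), EReal.toReal_coe, EReal.coe_eq_coe_iff,
      div_eq_iff hpos.ne']
    constructor <;> intro h <;> linarith
  constructor
  · rintro ⟨hy, hH⟩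
    have hy1 := S.neg_one_le_of_mem hN hy
    induction y with
    | bot => exact absurd hy1 (not_le.2 (EReal.bot_lt_coe _))
    | top =>
      by_cases h0 : (i : ℕ) = 0
      · by_cases hA : S.A i = 1
        · simp [fixPt, h0, hA]
        · exfalso
          have hlt : S.β < ⊤ := by
            have : Nonempty (Fin N) := ⟨i⟩
            obtain ⟨j, hj⟩ := exists_eq_ciSup_of_finite (f := S.fixPt)
            refine max_lt (EReal.coe_lt_top 0) ?_
            rw [← hj]
            by_cases hj0 : (j : ℕ) = 0
            · have : j = i := Fin.ext (by omega)
              rw [this, S.fixPt_zero i h0 hA]; exact EReal.coe_lt_top _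
            · rw [fixPt, if_neg hj0]; exact EReal.coe_lt_top _
          exact absurd hy.2 (not_le.2 hlt)
      · simp [H, h0] at hH
    | coe x =>
      have hx : -1 ≤ x := by exact_mod_cast hy1
      have hq := (hreal x hx).1 hH
      by_cases h0 : (i : ℕ) = 0
      · rw [S.B_first i h0] at hq
        by_cases hA : S.A i = 1
        · exfalso
          have h1 := S.quad_neg_one_lt i (by omega)
          rw [S.B_first i h0, hA] at h1
          rw [hA] at hq
          linarith
        · rw [S.fixPt_zero i h0 hA, EReal.coe_eq_coe_iff, eq_div_iff (by
            intro h; exact hA (by linarith))]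
          linarith
      · have hr := root_aux (S.B_pos i h0) (S.quad_neg_one i)
        rcases hr.2.2.2 x hx hq with h1 | ⟨h1, h2⟩
        · rw [fixPt, if_neg h0]; exact_mod_cast h1
        · exfalso
          have hl : (i : ℕ) + 1 = N := by
            by_contra hl
            have := S.quad_neg_one_lt i hl
            rw [h1] at hq
            linarith
          have hα : ((-1 : ℝ) : EReal) < S.α := by
            refine S.α_gt hN fun j hj => ?_
            have : j = i := Fin.ext (by omega)
            rw [this, fixPt, if_neg h0]
            exact_mod_cast h2
          have h3 := hα.trans_le hy.1
          rw [h1] at h3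
          exact lt_irrefl _ h3
  · rintro rfl
    refine ⟨S.fixPt_mem i, ?_⟩
    have hge := S.neg_one_le_fixPt hN i
    by_cases h0 : (i : ℕ) = 0
    · by_cases hA : S.A i = 1
      · simp [fixPt, H, h0, hA]
      · rw [S.fixPt_zero i h0 hA] at hge ⊢
        have hA' := S.A_first_lt i h0 hA
        refine (hreal _ (by exact_mod_cast hge)).2 ?_
        have : 1 - S.A i ≠ 0 := by linarith
        rw [S.B_first i h0]
        field_simp
        ring
    · rw [fixPt, if_neg h0] at hge ⊢
      exact (hreal _ (by exact_mod_cast hge)).2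
        (root_aux (S.B_pos i h0) (S.quad_neg_one i)).1

end LFSystem

/-! ### The conjugate equation and the measure of its solution -/

/-- `φ : [0,1] → [0,1]` is a continuous strictly increasing solution of the conjugate equation
`g_i ∘ φ = φ ∘ f_i`, `0 ≤ i < N`. -/
structure IsSolution {N : ℕ} (f : Fin N → unitInterval → unitInterval) (S : LFSystem N)
    (φ : unitInterval → unitInterval) : Prop where
  continuous : Continuous φ
  strictMono : StrictMono φ
  conj : ∀ i x, S.g i (φ x) = φ (f i x)

/-- The function `φ` extended to `ℝ` by `φ(0)` on the left and by `φ(1)` on the right. -/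
def distFun {φ : unitInterval → unitInterval} (hm : Monotone φ) (hc : Continuous φ) :
    StieltjesFunction ℝ where
  toFun x := φ (Set.projIcc 0 1 zero_le_one x)
  mono' := fun _ _ hxy => hm (Set.monotone_projIcc _ hxy)
  right_continuous' := fun _ =>
    (continuous_subtype_val.comp (hc.comp continuous_projIcc)).continuousWithinAt

/-- The measure `μ_φ` on `ℝ`, carried by `[0,1]`, with distribution function `φ`. -/
def IsSolution.μ {N : ℕ} {f : Fin N → unitInterval → unitInterval} {S : LFSystem N}
    {φ : unitInterval → unitInterval} (hφ : IsSolution f S φ) : MeasureTheory.Measure ℝ :=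
  (distFun hφ.strictMono.monotone hφ.continuous).measure

/-- The Hausdorff dimension of a measure carried by `[0,1]`: the infimum of `dim_H A` over the
Borel sets `A ⊆ [0,1]` of full measure `1`. -/
def dimHMeasure (μ : MeasureTheory.Measure ℝ) : ENNReal :=
  ⨅ (A : Set ℝ) (_ : MeasurableSet A) (_ : A ⊆ Set.Icc 0 1) (_ : μ A = 1), dimH A

end

end ConjugateEq

/-! The vectors `𝔭_i` coincide only if the maps `H_i` have a common fixed point `y`, and then `y` is
real and larger than `-1`. In terms of the maps `g_i` this means that all of them fix the point
`-1 / y` (infinity if `y = 0`) outside `[0,1]`. The Möbius transformation `chart y`, which fixes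
`0` and `1` and sends this point to infinity, therefore conjugates every `g_i` to an affine map,
whose slope is `p i = G_i(y)` (`LFSystem.chart_g`). Hence `ψ = chart y ∘ φ` is the distribution
function of the self-similar measure with the weights `p i` for the system `(f_i)`, and since the chart is
bi-Lipschitz on `[0,1]`, `μ_φ` gives the cylinder of a word `w` at most a constant times
`∏ p (w k)`, while the length of the cylinder is at most `∏ r (w k)`.

The dimension of such a measure is at most the quotient of `∑ p i log p i` and `∑ p i log r i`.
It is less than `1` if the relative entropy `∑ p i log (p i / r i)` is positive, and this follows
from `|r - p|₁ ≥ ε` and `∑ r i < 1 + δ` with `δ = ε² / (4 N)` by comparison with the Hellinger distance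
(`sum_mul_log_sub_log_neg`). The dimension bound itself (`dimHMeasure_lt_one`) is a Chernoff
estimate with the Borel-Cantelli lemma: for some `s < 1`, the words with
`∏ r (w k) ^ s > ∏ p (w k)` have exponentially small total mass, and the cylinders of the other
words of length `n` have `∑ ∏ r (w k) ^ s ≤ 1`. -/

namespace ConjugateEq

/-! ### Relative entropy and exponential moments -/

/-- A quantitative Gibbs inequality: the relative entropy `∑ p log (p / r)` is at least the
squared Hellinger distance of `p` and `r`, up to the difference of the total masses. It comes from
`log x ≤ x - 1` applied to `x = √r / √p`. -/
lemma sum_mul_log_sub_log_le {ι : Type*} [Fintype ι] {p r : ι → ℝ}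
    (hp : ∀ i, 0 < p i) (hr : ∀ i, 0 < r i) :
    ∑ i, p i * (Real.log (r i) - Real.log (p i)) ≤
      ∑ i, r i - ∑ i, p i - ∑ i, (√(r i) - √(p i)) ^ 2 := by
  rw [← Finset.sum_sub_distrib, ← Finset.sum_sub_distrib]
  refine Finset.sum_le_sum fun i _ => ?_
  have ha := Real.sqrt_pos.2 (hr i)
  have hb := Real.sqrt_pos.2 (hp i)
  have har := Real.sq_sqrt (hr i).le
  have hbp := Real.sq_sqrt (hp i).le
  set a := √(r i)
  set b := √(p i)
  rw [← har, ← hbp, Real.log_pow, Real.log_pow]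
  have h := Real.log_le_sub_one_of_pos (div_pos ha hb)
  rw [Real.log_div ha.ne' hb.ne'] at h
  have h2 := mul_le_mul_of_nonneg_left h (by positivity : 0 ≤ 2 * b ^ 2)
  have e : 2 * b ^ 2 * (a / b - 1) = a ^ 2 - b ^ 2 - (a - b) ^ 2 := by
    field_simp
    ring
  push_cast
  linarith

/-- If the weights `r i ≤ 1` stay at `ℓ¹`-distance `ε` from the probability vector `p` and have
total mass close to `1`, then the relative entropy of `p` with respect to `r` is positive. -/
lemma sum_mul_log_sub_log_neg {ι : Type*} [Fintype ι] [Nonempty ι] {p r : ι → ℝ} {ε : ℝ}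
    (hε : 0 < ε) (hp : ∀ i, 0 < p i) (hp1 : ∑ i, p i = 1) (hr : ∀ i, 0 < r i)
    (hr1 : ∀ i, r i ≤ 1) (hsum : ∑ i, r i < 1 + ε ^ 2 / (4 * Fintype.card ι))
    (hdist : ε ≤ ∑ i, |r i - p i|) :
    ∑ i, p i * (Real.log (r i) - Real.log (p i)) < 0 := by
  have hple : ∀ i, p i ≤ 1 := fun i =>
    hp1 ▸ Finset.single_le_sum (fun j _ => (hp j).le) (Finset.mem_univ i)
  have h1 : ε ≤ 2 * ∑ i, |√(r i) - √(p i)| := by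
    refine hdist.trans ?_
    rw [Finset.mul_sum]
    refine Finset.sum_le_sum fun i _ => ?_
    have e : r i - p i = (√(r i) + √(p i)) * (√(r i) - √(p i)) := by
      linear_combination -(Real.sq_sqrt (hr i).le) + Real.sq_sqrt (hp i).le
    rw [e, abs_mul, abs_of_nonneg (by positivity)]
    have := Real.sqrt_le_one.2 (hr1 i)
    have := Real.sqrt_le_one.2 (hple i)
    exact mul_le_mul_of_nonneg_right (by linarith) (abs_nonneg _)
  have h2 := sq_sum_le_card_mul_sum_sq (s := Finset.univ) (f := fun i => |√(r i) - √(p i)|)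
  simp only [sq_abs, Finset.card_univ] at h2
  have hN : (0 : ℝ) < Fintype.card ι := by exact_mod_cast Fintype.card_pos
  have h3 : ε ^ 2 / (4 * Fintype.card ι) ≤ ∑ i, (√(r i) - √(p i)) ^ 2 := by
    rw [div_le_iff₀ (by positivity)]
    nlinarith
  linarith [sum_mul_log_sub_log_le hp hr]

/-- Positive relative entropy leaves room for an exponent `s < 1` such that the logarithm of
`r i ^ s / p i` still has negative mean under `p`; a small moment of `r i ^ s / p i` is then less
than `1`. -/
lemma exists_moment_lt_one {ι : Type*} [Fintype ι] {p r : ι → ℝ} (hp : ∀ i, 0 < p i)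
    (hp1 : ∑ i, p i = 1) (hr : ∀ i, 0 < r i)
    (h : ∑ i, p i * (Real.log (r i) - Real.log (p i)) < 0) :
    ∃ s t : ℝ, 0 < s ∧ s < 1 ∧ 0 < t ∧ ∑ i, p i * (r i ^ s / p i) ^ t < 1 := by
  obtain ⟨s, ⟨hs0, hs1⟩, hmean⟩ : ∃ s ∈ Set.Ioo (0 : ℝ) 1,
      ∑ i, p i * (s * Real.log (r i) - Real.log (p i)) < 0 := by
    have hc : ContinuousAt
        (fun s : ℝ => ∑ i, p i * (s * Real.log (r i) - Real.log (p i))) 1 := by fun_prop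
    have hev := (hc.tendsto.eventually (gt_mem_nhds (by simpa using h))).filter_mono
      (nhdsWithin_le_nhds (s := Set.Iio 1))
    obtain ⟨s, h1, h2⟩ := (hev.and (Ioo_mem_nhdsLT zero_lt_one)).exists
    exact ⟨s, h2, h1⟩
  set u : ι → ℝ := fun i => s * Real.log (r i) - Real.log (p i) with hu
  have hder : HasDerivAt (fun t : ℝ => ∑ i, p i * Real.exp (t * u i)) (∑ i, p i * u i) 0 := by
    refine HasDerivAt.fun_sum fun i _ => ?_
    have := (((hasDerivAt_id (0 : ℝ)).mul_const (u i)).exp).const_mul (p i)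
    simpa using this
  have hev := hder.tendsto_slope_zero_right.eventually (gt_mem_nhds hmean)
  obtain ⟨t, ht, ht0⟩ := (hev.and self_mem_nhdsWithin).exists
  have ht0 : 0 < t := ht0
  refine ⟨s, t, hs0, hs1, ht0, ?_⟩
  simp only [zero_add, zero_mul, Real.exp_zero, mul_one, hp1, smul_eq_mul] at ht
  have e : ∀ i, (r i ^ s / p i) ^ t = Real.exp (t * u i) := fun i => by
    have := Real.rpow_pos_of_pos (hr i) s
    rw [Real.rpow_def_of_pos (div_pos this (hp i)), Real.log_div this.ne' (hp i).ne',
      Real.log_rpow (hr i), mul_comm]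
  simp only [e]
  by_contra hcon
  exact absurd ht (not_lt.2 (mul_nonneg (inv_pos.2 ht0).le (by linarith)))

/-! ### Words and the iterated function system -/

/-- The composition `f (w 0) ∘ f (w 1) ∘ ⋯ ∘ f (w (n - 1))` of a family of self-maps along the
word `w` of length `n`. -/
def wordMap {ι α : Type*} (f : ι → α → α) : ∀ {n : ℕ}, (Fin n → ι) → α → α
  | 0, _ => id
  | _ + 1, w => f (w 0) ∘ wordMap f (Fin.tail w)

variable {ι : Type*}

lemma wordMap_strictMono {α : Type*} [Preorder α] {f : ι → α → α} (hf : ∀ i, StrictMono (f i)) :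
    ∀ {n : ℕ} (w : Fin n → ι), StrictMono (wordMap f w)
  | 0, _ => strictMono_id
  | _ + 1, w => (hf (w 0)).comp (wordMap_strictMono hf (Fin.tail w))

/-- If the maps `f i` together cover the space, so do their compositions of any length. -/
lemma exists_wordMap_eq {α : Type*} {f : ι → α → α} (hf : ∀ x, ∃ i z, f i z = x) :
    ∀ (n : ℕ) (x : α), ∃ (w : Fin n → ι) (z : α), wordMap f w z = x
  | 0, x => ⟨Fin.elim0, x, rfl⟩
  | n + 1, x => by
    obtain ⟨i, z, rfl⟩ := hf x
    obtain ⟨w, z', rfl⟩ := exists_wordMap_eq hf n z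
    exact ⟨Fin.cons i w, z', by simp [wordMap]⟩

lemma abs_wordMap_sub_le {f : ι → unitInterval → unitInterval} {r : ι → ℝ} (hr : ∀ i, 0 ≤ r i)
    (hf : ∀ i x y, |(f i x : ℝ) - f i y| ≤ r i * |(x : ℝ) - y|) :
    ∀ {n : ℕ} (w : Fin n → ι) (x y : unitInterval),
      |((wordMap f w x : unitInterval) : ℝ) - (wordMap f w y : unitInterval)| ≤
        (∏ k, r (w k)) * |(x : ℝ) - y|
  | 0, _, x, y => by simp [wordMap]
  | n + 1, w, x, y => by
    rw [Fin.prod_univ_succ, mul_assoc]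
    exact (hf _ _ _).trans
      (mul_le_mul_of_nonneg_left (abs_wordMap_sub_le hr hf (Fin.tail w) x y) (hr _))

/-- A function that conjugates the maps `f i` to affine maps of slope `p i` multiplies
differences by the product of the slopes along a word. -/
lemma conj_wordMap_sub {α : Type*} {f : ι → α → α} {p q : ι → ℝ} {ψ : α → ℝ}
    (h : ∀ i x, ψ (f i x) = p i * ψ x + q i) :
    ∀ {n : ℕ} (w : Fin n → ι) (x y : α),
      ψ (wordMap f w x) - ψ (wordMap f w y) = (∏ k, p (w k)) * (ψ x - ψ y)
  | 0, _, x, y => by simp [wordMap]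
  | n + 1, w, x, y => by
    rw [Fin.prod_univ_succ, mul_assoc]
    have : _ = (∏ k : Fin n, p (w k.succ)) * _ := conj_wordMap_sub h (Fin.tail w) x y
    simp only [wordMap, Function.comp_apply, h]
    linear_combination p (w 0) * this

/-- The images of the maps of a compatible system cover the interval. -/
lemma IsCompatibleSystem.exists_eq {N : ℕ} {f : Fin N → unitInterval → unitInterval}
    (hf : IsCompatibleSystem f) (hN : 0 < N) (x : unitInterval) : ∃ i z, f i z = x := by
  have key : ∀ k (hk : k < N), x ≤ f ⟨k, hk⟩ 1 → ∃ i z, f i z = x := by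
    intro k
    induction k with
    | zero =>
      intro hk hx
      obtain ⟨z, -, hz⟩ := intermediate_value_Icc (zero_le_one' unitInterval)
        (hf.continuous ⟨0, hk⟩).continuousOn ⟨by rw [hf.first _ rfl]; exact bot_le, hx⟩
      exact ⟨_, z, hz⟩
    | succ k ih =>
      intro hk hx
      rcases le_total x (f ⟨k, by omega⟩ 1) with h | h
      · exact ih _ h
      · obtain ⟨z, -, hz⟩ := intermediate_value_Icc (zero_le_one' unitInterval)
          (hf.continuous ⟨k + 1, hk⟩).continuousOn
          ⟨by rwa [← hf.glue ⟨k, by omega⟩ ⟨k + 1, hk⟩ rfl], hx⟩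
        exact ⟨_, z, hz⟩
  exact key (N - 1) (by omega) (by rw [hf.last _ (by simp; omega)]; exact le_top)

lemma IsContraction.abs_sub_le {h : unitInterval → unitInterval} (hh : IsContraction h)
    (x y : unitInterval) : |(h x : ℝ) - h y| ≤ lip h * |(x : ℝ) - y| := by
  rcases eq_or_ne x y with rfl | hxy
  · simp
  have hpos : 0 < |(x : ℝ) - y| := abs_pos.2 (sub_ne_zero.2 fun e => hxy (Subtype.ext e))
  rw [← div_le_iff₀ hpos]
  have h1 : ENNReal.ofReal (|(h x : ℝ) - (h y : ℝ)| / |(x : ℝ) - (y : ℝ)|) ≤ elip h :=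
    le_iSup₂_of_le x y (le_iSup_of_le hxy le_rfl)
  have hfin : elip h ≠ ⊤ := (lt_trans hh ENNReal.one_lt_top).ne
  rw [ENNReal.ofReal_le_iff_le_toReal hfin] at h1
  exact h1

open MeasureTheory Filter Topology

/-! ### The dimension bound -/

lemma sum_subtype_le_sum {α : Type*} [Fintype α] (P : α → Prop) [DecidablePred P]
    (F : α → ENNReal) : ∑ a : {a // P a}, F a ≤ ∑ a, F a := by
  rw [← Fintype.sum_subtype_add_sum_subtype P F]
  exact le_self_add

/-- Let `μ` give mass at most `C ∏ p (w k)` to the cylinder of each word `w`, while the maps have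
Lipschitz constants `r i`. If the relative entropy of `p` with respect to `r` is positive, then
`μ` lives on a set of dimension less than `1`: for a suitable `s < 1`, almost every point
lies, for all large `n`, in a cylinder of length `n` with `∏ r (w k) ^ s ≤ ∏ p (w k)`, and the sum
of `∏ r (w k) ^ s` over these cylinders is at most `1`. -/
theorem dimHMeasure_lt_one {ι : Type*} [Fintype ι] {f : ι → unitInterval → unitInterval}
    {p r : ι → ℝ} {C ρ : ℝ} (hmono : ∀ i, StrictMono (f i)) (hcov : ∀ x, ∃ i z, f i z = x)
    (hp : ∀ i, 0 < p i) (hp1 : ∑ i, p i = 1) (hr : ∀ i, 0 < r i) (hrρ : ∀ i, r i ≤ ρ)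
    (hρ0 : 0 ≤ ρ) (hρ1 : ρ < 1) (hf : ∀ i x y, |(f i x : ℝ) - f i y| ≤ r i * |(x : ℝ) - y|)
    (hent : ∑ i, p i * (Real.log (r i) - Real.log (p i)) < 0) {μ : Measure ℝ}
    (hμ1 : μ (Set.Icc 0 1) = 1) (hC : 0 ≤ C)
    (hμ : ∀ (n : ℕ) (w : Fin n → ι),
      μ (Set.Icc ((wordMap f w 0 : unitInterval) : ℝ) (wordMap f w 1 : unitInterval)) ≤
        ENNReal.ofReal (C * ∏ k, p (w k))) :
    dimHMeasure μ < 1 := by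
  classical
  obtain ⟨s, t, hs0, hs1, ht0, hM⟩ := exists_moment_lt_one hp hp1 hr hent
  set v : ι → ℝ := fun i => r i ^ s / p i with hv
  have hv0 : ∀ i, 0 < v i := fun i => div_pos (Real.rpow_pos_of_pos (hr i) s) (hp i)
  set M := ∑ i, p i * v i ^ t with hMdef
  have hM0 : 0 ≤ M :=
    Finset.sum_nonneg fun i _ => mul_nonneg (hp i).le (Real.rpow_nonneg (hv0 i).le t)
  have hpw : ∀ {n : ℕ} (w : Fin n → ι), 0 < ∏ k, p (w k) :=
    fun w => Finset.prod_pos fun k _ => hp _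
  have hrw : ∀ {n : ℕ} (w : Fin n → ι), 0 < ∏ k, r (w k) :=
    fun w => Finset.prod_pos fun k _ => hr _
  have hvw : ∀ {n : ℕ} (w : Fin n → ι), ∏ k, v (w k) = (∏ k, r (w k)) ^ s / ∏ k, p (w k) :=
    fun w => by
      rw [← Real.finsetProd_rpow _ _ fun k _ => (hr _).le, ← Finset.prod_div_distrib]
  let J : ∀ {n : ℕ}, (Fin n → ι) → Set ℝ := fun w =>
    Set.Icc ((wordMap f w 0 : unitInterval) : ℝ) (wordMap f w 1 : unitInterval)
  let good : ∀ {n : ℕ}, (Fin n → ι) → Prop := fun w => ∏ k, v (w k) ≤ 1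
  let U : ℕ → Set ℝ := fun n => ⋃ w : {w : Fin n → ι // good w}, J w.1
  let V : ℕ → Set ℝ := fun n => ⋃ w : {w : Fin n → ι // ¬ good w}, J w.1
  have hUV : ∀ n, Set.Icc 0 1 ⊆ U n ∪ V n := by
    intro n x hx
    obtain ⟨w, z, hz⟩ := exists_wordMap_eq hcov n ⟨x, hx⟩
    have hxJ : x ∈ J w := by
      have hm := (wordMap_strictMono hmono w).monotone
      have h0 : wordMap f w 0 ≤ ⟨x, hx⟩ := hz ▸ hm bot_le
      have h1 : (⟨x, hx⟩ : unitInterval) ≤ wordMap f w 1 := hz ▸ hm le_top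
      exact ⟨h0, h1⟩
    by_cases hg : good w
    · exact Or.inl (Set.mem_iUnion.2 ⟨⟨w, hg⟩, hxJ⟩)
    · exact Or.inr (Set.mem_iUnion.2 ⟨⟨w, hg⟩, hxJ⟩)
  have hV : ∀ n, μ (V n) ≤ ENNReal.ofReal (C * M ^ n) := by
    intro n
    calc μ (V n) ≤ ∑ w : {w : Fin n → ι // ¬ good w}, μ (J w.1) := measure_iUnion_fintype_le _ _
      _ ≤ ∑ w : {w : Fin n → ι // ¬ good w}, 
          ENNReal.ofReal (C * ∏ k, p (w.1 k) * v (w.1 k) ^ t) := by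
        refine Finset.sum_le_sum fun w _ => (hμ n w.1).trans (ENNReal.ofReal_le_ofReal ?_)
        have h1 : 1 ≤ (∏ k, v (w.1 k)) ^ t := Real.one_le_rpow (not_le.1 w.2).le ht0.le
        rw [Finset.prod_mul_distrib, Real.finsetProd_rpow _ _ fun k _ => (hv0 _).le]
        exact mul_le_mul_of_nonneg_left (le_mul_of_one_le_right (hpw _).le h1) hC
      _ ≤ ∑ w : Fin n → ι, ENNReal.ofReal (C * ∏ k, p (w k) * v (w k) ^ t) := by
        exact sum_subtype_le_sum (fun w => ¬ good w)
          fun w : Fin n → ι => ENNReal.ofReal (C * ∏ k, p (w k) * v (w k) ^ t)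
      _ = ENNReal.ofReal (C * M ^ n) := by
        rw [← ENNReal.ofReal_sum_of_nonneg fun w _ => mul_nonneg hC
          (Finset.prod_nonneg fun k _ => mul_nonneg (hp _).le (Real.rpow_nonneg (hv0 _).le t)),
          ← Finset.mul_sum, Fintype.sum_pow]
  have hlim : μ (limsup V atTop) = 0 := by
    refine measure_limsup_atTop_eq_zero (ne_top_of_le_ne_top ?_ (ENNReal.tsum_le_tsum hV))
    exact ((summable_geometric_of_lt_one hM0 hM).mul_left C).tsum_ofReal_ne_top
  let B : ℕ → Set ℝ := fun m => Set.Icc 0 1 ∩ ⋂ n ≥ m, U n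
  have hUm : ∀ n, MeasurableSet (U n) := fun n => MeasurableSet.iUnion fun w => measurableSet_Icc
  have hBm : MeasurableSet (⋃ m, B m) := MeasurableSet.iUnion fun m =>
    measurableSet_Icc.inter (MeasurableSet.biInter (Set.to_countable _) fun n _ => hUm n)
  have hBsub : (⋃ m, B m) ⊆ Set.Icc 0 1 := Set.iUnion_subset fun m => Set.inter_subset_left
  have hsplit : Set.Icc 0 1 ⊆ (⋃ m, B m) ∪ limsup V atTop := by
    intro x hx
    by_cases hxV : x ∈ limsup V atTop
    · exact Or.inr hxV
    · -- from some `m` on, `x` avoids the cylinders of the bad words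
      rw [mem_limsup_iff_frequently_mem, not_frequently, eventually_atTop] at hxV
      obtain ⟨m, hm⟩ := hxV
      refine Or.inl (Set.mem_iUnion.2 ⟨m, hx, Set.mem_iInter₂.2 fun n hn => ?_⟩)
      exact (hUV n hx).resolve_right (hm n hn)
  have hB1 : μ (⋃ m, B m) = 1 := by
    refine le_antisymm (hμ1 ▸ measure_mono hBsub) ?_
    calc (1 : ENNReal) = μ (Set.Icc 0 1) := hμ1.symm
      _ ≤ μ (⋃ m, B m) + μ (limsup V atTop) := (measure_mono hsplit).trans (measure_union_le _ _)
      _ = μ (⋃ m, B m) := by rw [hlim, add_zero]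
  have hJ : ∀ {n : ℕ} (w : Fin n → ι), Metric.ediam (J w) ≤ ENNReal.ofReal (∏ k, r (w k)) := by
    intro n w
    rw [Real.ediam_Icc]
    refine ENNReal.ofReal_le_ofReal ((le_abs_self _).trans ?_)
    simpa using abs_wordMap_sub_le (fun i => (hr i).le) hf w 1 0
  have hdim : dimH (⋃ m, B m) ≤ s.toNNReal := by
    rw [dimH_iUnion]
    refine iSup_le fun m => dimH_le_of_hausdorffMeasure_ne_top (ne_top_of_le_ne_top
      ENNReal.one_ne_top ?_)
    rw [Real.coe_toNNReal _ hs0.le]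
    refine (Measure.hausdorffMeasure_le_liminf_sum (l := atTop) s (B m)
      (fun n : ℕ => ENNReal.ofReal (ρ ^ n)) ?_
      (fun n (w : {w : Fin n → ι // good w}) => J w.1) ?_ ?_).trans ?_
    · simpa using ENNReal.tendsto_ofReal (tendsto_pow_atTop_nhds_zero_of_lt_one hρ0 hρ1)
    · refine Eventually.of_forall fun n w => (hJ w.1).trans (ENNReal.ofReal_le_ofReal ?_)
      simpa using Finset.prod_le_prod (s := Finset.univ) (fun k _ => (hr (w.1 k)).le)
        (fun k _ => hrρ (w.1 k))
    · filter_upwards [eventually_ge_atTop m] with n hn x hx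
      exact Set.mem_iInter₂.1 hx.2 n hn
    · refine liminf_le_of_le (by isBoundedDefault) fun b hb => ?_
      obtain ⟨n, hn⟩ := hb.exists
      refine hn.trans ?_
      calc ∑ w : {w : Fin n → ι // good w}, Metric.ediam (J w.1) ^ s
          ≤ ∑ w : {w : Fin n → ι // good w}, ENNReal.ofReal (∏ k, p (w.1 k)) := by
            refine Finset.sum_le_sum fun w _ =>
              (ENNReal.rpow_le_rpow (hJ w.1) hs0.le).trans ?_
            rw [ENNReal.ofReal_rpow_of_pos (hrw _)]
            refine ENNReal.ofReal_le_ofReal ?_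
            have hg : ∏ k, v (w.1 k) ≤ 1 := w.2
            rwa [hvw, div_le_one (hpw _)] at hg
        _ ≤ ∑ w : Fin n → ι, ENNReal.ofReal (∏ k, p (w k)) := by
            exact sum_subtype_le_sum (fun w => good w)
              fun w : Fin n → ι => ENNReal.ofReal (∏ k, p (w k))
        _ = 1 := by
            rw [← ENNReal.ofReal_sum_of_nonneg fun w _ => (hpw w).le, ← Fintype.sum_pow, hp1,
              one_pow, ENNReal.ofReal_one]
  refine lt_of_le_of_lt (iInf₂_le_of_le _ hBm (iInf₂_le_of_le hBsub hB1 hdim)) ?_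
  rw [ENNReal.coe_lt_one_iff, Real.toNNReal_lt_one]
  exact hs1

/-! ### The projective chart that makes the system affine -/

/-- The Möbius transformation `x ↦ (y + 1) x / (y x + 1)`. It fixes `0` and `1` and sends `-1 / y`
to infinity; for `y > -1` it is an increasing bijection of `[0,1]`. -/
noncomputable def chart (y x : ℝ) : ℝ := (y + 1) * x / (y * x + 1)

lemma mul_add_one_pos {y x : ℝ} (hy : -1 < y) (hx : x ∈ Set.Icc (0 : ℝ) 1) : 0 < y * x + 1 := by
  rcases hx.1.eq_or_lt with h | h
  · simp [← h]
  · nlinarith [hx.2]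

lemma chart_sub_chart {y x x' : ℝ} (hy : -1 < y) (hx : x ∈ Set.Icc (0 : ℝ) 1)
    (hx' : x' ∈ Set.Icc (0 : ℝ) 1) :
    chart y x' - chart y x = (x' - x) * (y + 1) / ((x' * y + 1) * (x * y + 1)) := by
  have h1 := mul_add_one_pos hy hx
  have h2 := mul_add_one_pos hy hx'
  rw [chart, chart, mul_comm x' y, mul_comm x y, div_sub_div _ _ h2.ne' h1.ne']
  congr 1
  ring

@[simp] lemma chart_zero (y : ℝ) : chart y 0 = 0 := by simp [chart]

lemma chart_one {y : ℝ} (hy : -1 < y) : chart y 1 = 1 := by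
  have : y + 1 ≠ 0 := by linarith
  simp [chart, this]

lemma sub_le_mul_chart_sub {y x x' : ℝ} (hy : -1 < y) (hx : x ∈ Set.Icc (0 : ℝ) 1)
    (hx' : x' ∈ Set.Icc (0 : ℝ) 1) (hxx' : x ≤ x') :
    x' - x ≤ (|y| + 1) ^ 2 / (y + 1) * (chart y x' - chart y x) := by
  have hy1 : 0 < y + 1 := by linarith
  have h1 := mul_add_one_pos hy hx
  have h2 := mul_add_one_pos hy hx'
  rw [mul_comm] at h1 h2
  have bound : ∀ z ∈ Set.Icc (0 : ℝ) 1, z * y + 1 ≤ |y| + 1 := fun z hz => by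
    nlinarith [le_abs_self y, abs_nonneg y, hz.1, hz.2, mul_le_mul_of_nonneg_left
      (le_abs_self y) hz.1, mul_le_mul_of_nonneg_right hz.2 (abs_nonneg y)]
  have h3 : (x' * y + 1) * (x * y + 1) ≤ (|y| + 1) ^ 2 := by
    rw [sq]
    exact mul_le_mul (bound x' hx') (bound x hx) h1.le (by positivity)
  rw [chart_sub_chart hy hx hx', div_mul_div_comm, le_div_iff₀ (by positivity)]
  have := mul_le_mul_of_nonneg_left h3 (mul_nonneg (sub_nonneg.2 hxx') hy1.le)
  linarith

namespace LFSystem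

variable {N : ℕ} (S : LFSystem N)

lemma g_zero_mem (i : Fin N) : S.g i 0 ∈ Set.Icc (0 : ℝ) 1 := by
  rw [← S.B_eq]
  exact ⟨S.B_nonneg i, (S.B_lt_one i).le⟩

lemma g_one_mem (i : Fin N) : S.g i 1 ∈ Set.Icc (0 : ℝ) 1 :=
  ⟨(S.g_zero_mem i).1.trans (S.g_zero_lt_g_one i).le, S.g_one_le i⟩

lemma G_coe (i : Fin N) {y : ℝ} (hy : -1 < y) :
    S.G i (y : EReal) = chart y (S.g i 1) - chart y (S.g i 0) := by
  have h : (y : EReal) ≠ ((-1 : ℝ) : EReal) := fun e => hy.ne' (EReal.coe_eq_coe_iff.1 e)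
  rw [G, if_neg (EReal.coe_ne_top y), if_neg h, EReal.toReal_coe,
    chart_sub_chart hy (S.g_zero_mem i) (S.g_one_mem i)]

lemma G_coe_pos (i : Fin N) {y : ℝ} (hy : -1 < y) : 0 < S.G i (y : EReal) := by
  rw [S.G_coe i hy, chart_sub_chart hy (S.g_zero_mem i) (S.g_one_mem i)]
  have h0 := mul_add_one_pos hy (S.g_zero_mem i)
  have h1 := mul_add_one_pos hy (S.g_one_mem i)
  rw [mul_comm] at h0 h1
  exact div_pos (mul_pos (sub_pos.2 (S.g_zero_lt_g_one i)) (by linarith)) (mul_pos h1 h0)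

/-- The weights `G_i(y)` are the lengths of a partition of the unit interval. -/
lemma sum_G_coe (hN : 0 < N) {y : ℝ} (hy : -1 < y) : ∑ i, S.G i (y : EReal) = 1 := by
  set e : ℕ → ℝ := fun k => if h : k < N then chart y (S.g ⟨k, h⟩ 0) else 1 with he
  have h1 : ∀ i : Fin N, S.G i (y : EReal) = e (i + 1) - e i := by
    intro i
    rw [S.G_coe i hy]
    simp only [he, i.2, dif_pos]
    congr 1
    by_cases h : (i : ℕ) + 1 < N
    · rw [dif_pos h, S.g_glue i ⟨i + 1, h⟩ rfl]
    · rw [dif_neg h, S.g_last i (by omega), chart_one hy]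
  simp_rw [h1]
  rw [Fin.sum_univ_eq_sum_range (fun k => e (k + 1) - e k) N, Finset.sum_range_sub]
  have hg : S.g ⟨0, hN⟩ 0 = 0 := by rw [← S.B_eq, S.B_first _ rfl]
  simp [he, hN, hg]

/-- The first weight determines `y ∈ [-1, +∞]` as soon as there are at least two maps. -/
lemma G_first_injOn {i : Fin N} (hi : (i : ℕ) = 0) (hN : 2 ≤ N) :
    Set.InjOn (S.G i) (Set.Ici ((-1 : ℝ) : EReal)) := by
  set b := S.g i 1 with hb
  have hg0 : S.g i 0 = 0 := by rw [← S.B_eq, S.B_first _ hi]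
  have hb0 : 0 < b := by simpa [hg0] using S.g_zero_lt_g_one i
  have hb1 : b < 1 := S.g_one_lt _ (by omega)
  have hpos : ∀ x : ℝ, -1 ≤ x → 0 < b * x + 1 := fun x hx => by nlinarith
  have hval : ∀ x : ℝ, -1 ≤ x →
      S.G i (x : EReal) = b * (x + 1) / (b * x + 1) := by
    intro x hx
    rcases hx.eq_or_lt with rfl | h
    · have h1N : (i : ℕ) + 1 ≠ N := by omega
      rw [G, if_neg (EReal.coe_ne_top _), if_pos rfl, if_neg h1N]
      simp
    · have h : (x : EReal) ≠ ((-1 : ℝ) : EReal) := fun e => h.ne' (EReal.coe_eq_coe_iff.1 e)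
      rw [G, if_neg (EReal.coe_ne_top x), if_neg h, EReal.toReal_coe, hg0, ← hb]
      simp
  have htop : S.G i ⊤ = 1 := by simp [G, hi]
  have hne : ∀ x : ℝ, -1 ≤ x → S.G i (x : EReal) ≠ 1 := by
    intro x hx h
    rw [hval x hx, div_eq_one_iff_eq (hpos x hx).ne'] at h
    linarith
  intro x hx z hz hxz
  induction x with
  | bot => exact absurd hx (not_le.2 (EReal.bot_lt_coe _))
  | top =>
    induction z with
    | bot => exact absurd hz (not_le.2 (EReal.bot_lt_coe _))
    | top => rfl
    | coe z => exact absurd (hxz.symm.trans htop) (hne z (EReal.coe_le_coe_iff.1 hz))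
  | coe x =>
    have hx : -1 ≤ x := EReal.coe_le_coe_iff.1 hx
    induction z with
    | bot => exact absurd hz (not_le.2 (EReal.bot_lt_coe _))
    | top => exact absurd (hxz.trans htop) (hne x hx)
    | coe z =>
      have hz : -1 ≤ z := EReal.coe_le_coe_iff.1 hz
      rw [hval x hx, hval z hz, div_eq_div_iff (hpos x hx).ne' (hpos z hz).ne'] at hxz
      have h1 : b * (1 - b) * (x - z) = 0 := by linear_combination hxz
      have h2 : b * (1 - b) ≠ 0 := (mul_pos hb0 (by linarith)).ne'
      rw [sub_eq_zero.1 ((mul_eq_zero.1 h1).resolve_left h2)]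

/-- If the vectors `𝔭_i` coincide, then the maps `H_i` have a common fixed point, and it is a real
number larger than `-1`: the value `+∞` is excluded for the indices `i ≥ 1`, the value `-1` for
the index `0`. -/
lemma exists_fixPt_eq (hN : 2 ≤ N) (hp : ∀ i j, S.p i = S.p j) :
    ∃ y : ℝ, -1 < y ∧ ∀ i, S.fixPt i = y := by
  have heq : ∀ i j, S.fixPt i = S.fixPt j := fun i j =>
    S.G_first_injOn (i := ⟨0, by omega⟩) rfl hN (S.neg_one_le_fixPt hN i) (S.neg_one_le_fixPt hN j)
      (congrFun (hp i j) ⟨0, by omega⟩)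
  obtain ⟨y, hy⟩ : ∃ y : ℝ, S.fixPt ⟨1, by omega⟩ = y := by simp [fixPt]
  have hall : ∀ i, S.fixPt i = y := fun i => (heq i _).trans hy
  have hlt := S.neg_one_lt_fixPt ⟨0, by omega⟩ (by simp; omega)
  rw [hall] at hlt
  exact ⟨y, by exact_mod_cast hlt, hall⟩

/-- If `y` is the fixed point of `H_i`, then `g_i` fixes `-1 / y`, so that it becomes affine in the
chart which sends this point to infinity. -/
lemma chart_g (hN : 2 ≤ N) (i : Fin N) {y x : ℝ} (hy : -1 < y) (hi : S.fixPt i = y)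
    (hx : x ∈ Set.Icc (0 : ℝ) 1) :
    chart y (S.g i x) = S.G i (y : EReal) * chart y x + chart y (S.g i 0) := by
  have hd := S.d_pos i
  have hC := S.one_add_C_pos i
  have hCx : 0 < S.C i * x + 1 := by
    rw [mul_comm]
    rcases hx.2.eq_or_lt with h | h
    · rw [h]; linarith
    · nlinarith [hx.1]
  have hBy : 0 < S.B i * y + 1 := by
    rw [mul_comm, S.B_eq]; exact mul_add_one_pos hy (S.g_zero_mem i)
  have hyx := mul_add_one_pos hy hx
  have hH : S.A i * y + S.C i = y * (S.B i * y + 1) := by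
    have h : S.fixPt i ∈ {y | y ∈ S.Y ∧ S.H i y = y} := by rw [S.fixedPoints_eq hN i]; rfl
    have h2 := h.2
    rw [hi, H, if_neg (EReal.coe_ne_top y), EReal.toReal_coe, EReal.coe_eq_coe_iff,
      div_eq_iff hBy.ne'] at h2
    exact h2
  have hg : ∀ z, S.g i z = (S.A i * z + S.B i) / (S.C i * z + 1) := by
    intro z
    have e1 : S.A i * z + S.B i = (S.a i * z + S.b i) / S.d i := by unfold A B; field_simp
    have e2 : S.C i * z + 1 = (S.c i * z + S.d i) / S.d i := by unfold C; field_simp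
    rw [e1, e2, div_div_div_cancel_right₀ hd.ne', g]
  have key : ∀ z ∈ Set.Icc (0 : ℝ) 1, 0 < S.C i * z + 1 → chart y (S.g i z) =
      (S.A i - S.B i * y) / (S.B i * y + 1) * chart y z + chart y (S.g i 0) := by
    intro z hz hCz
    have hyz := (mul_add_one_pos hy hz).ne'
    have hCz' := hCz.ne'
    have hBy' := hBy.ne'
    have e : y * S.g i z + 1 = (S.B i * y + 1) * (y * z + 1) / (S.C i * z + 1) := by
      rw [hg, eq_div_iff hCz', add_mul, mul_assoc, div_mul_cancel₀ _ hCz']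
      linear_combination z * hH
    have e0 : chart y (S.g i 0) = (y + 1) * S.B i / (S.B i * y + 1) := by
      rw [← S.B_eq, chart, mul_comm y]
    rw [e0, chart, e, hg z, ← mul_div_assoc, div_div_div_cancel_right₀ hCz', chart]
    field_simp
    ring
  have hslope : S.G i (y : EReal) = (S.A i - S.B i * y) / (S.B i * y + 1) := by
    rw [S.G_coe i hy, key 1 (by simp) (by linarith), chart_one hy]
    ring
  rw [hslope, key x hx hCx]

end LFSystem

/-! ### The measure of the conjugacy -/

lemma IsSolution.μ_Icc {N : ℕ} {f : Fin N → unitInterval → unitInterval} {S : LFSystem N}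
    {φ : unitInterval → unitInterval} (hφ : IsSolution f S φ) (x z : unitInterval) :
    hφ.μ (Set.Icc (x : ℝ) z) = ENNReal.ofReal ((φ z : ℝ) - φ x) := by
  have hc : Continuous (distFun hφ.strictMono.monotone hφ.continuous) :=
    continuous_subtype_val.comp (hφ.continuous.comp continuous_projIcc)
  have hval : ∀ u : unitInterval,
      distFun hφ.strictMono.monotone hφ.continuous (u : ℝ) = φ u := fun u => by
    change ((φ (Set.projIcc 0 1 zero_le_one (u : ℝ)) : unitInterval) : ℝ) = φ u
    rw [Set.projIcc_val]
  rw [IsSolution.μ, StieltjesFunction.measure_Icc,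
    hc.continuousAt.continuousWithinAt.leftLim_eq, hval, hval]

/-- A solution of `ψ ∘ f_i = p_i ψ + q_i` takes, at the end points, which are fixed by the first and
the last of the maps `f_i`, the fixed points of the first and the last affine map. -/
lemma conj_zero_one {N : ℕ} {f : Fin N → unitInterval → unitInterval}
    (hf : IsCompatibleSystem f) {p q : Fin N → ℝ} (hp : ∀ i, p i < 1) {i j : Fin N}
    (hi : (i : ℕ) = 0) (hj : (j : ℕ) + 1 = N) (hq0 : q i = 0) (hq1 : p j + q j = 1)
    {ψ : unitInterval → ℝ} (h : ∀ i x, ψ (f i x) = p i * ψ x + q i) : ψ 0 = 0 ∧ ψ 1 = 1 := by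
  constructor
  · have h0 := h i 0
    rw [hf.first _ hi, hq0] at h0
    have h1 : (1 - p i) * ψ 0 = 0 := by linear_combination h0
    exact (mul_eq_zero.1 h1).resolve_left (sub_pos.2 (hp _)).ne'
  · have h0 := h j 1
    rw [hf.last _ hj] at h0
    have h1 : (1 - p j) * (ψ 1 - 1) = 0 := by linear_combination h0 + hq1
    exact sub_eq_zero.1 ((mul_eq_zero.1 h1).resolve_left (sub_pos.2 (hp _)).ne')

end ConjugateEq

/-! ### Conclusion -/

open ConjugateEq in
theorem theorem3p3 {N : ℕ} (hN : 2 ≤ N) (S : ConjugateEq.LFSystem N)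
    (hp : ∀ i j : Fin N, S.p i = S.p j)
    (ε : ℝ) (hε : 0 < ε) (hε' : ε < 1 / 2) :
    ∃ δ : ℝ, 0 < δ ∧
      ∀ f : Fin N → unitInterval → unitInterval, ConjugateEq.IsContractiveSystem f →
        (∀ i, ε ≤ ConjugateEq.lip (f i) ∧ ConjugateEq.lip (f i) ≤ 1 - ε) →
        ∑ i, ConjugateEq.lip (f i) < 1 + δ →
        ε ≤ ∑ i, |ConjugateEq.lip (f i) - S.p ⟨0, by omega⟩ i| →
        ∀ (φ : unitInterval → unitInterval) (hφ : ConjugateEq.IsSolution f S φ),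
          ConjugateEq.dimHMeasure hφ.μ < 1 := by
  obtain ⟨y, hy, hfix⟩ := S.exists_fixPt_eq hN hp
  have : Nonempty (Fin N) := ⟨⟨0, by omega⟩⟩
  have : Nontrivial (Fin N) := Fin.nontrivial_iff_two_le.2 hN
  set p : Fin N → ℝ := fun i => S.G i (y : EReal) with hpdef
  have hpS : S.p ⟨0, by omega⟩ = p := by
    funext i
    rw [LFSystem.p, hfix]
  have hp0 : ∀ i, 0 < p i := fun i => S.G_coe_pos i hy
  have hp1 : ∑ i, p i = 1 := S.sum_G_coe (by omega) hy
  have hplt : ∀ i, p i < 1 := fun i => by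
    obtain ⟨j, hj⟩ := exists_ne i
    exact hp1 ▸ Finset.single_lt_sum hj (Finset.mem_univ i) (Finset.mem_univ j) (hp0 j)
      fun k _ _ => (hp0 k).le
  have hNpos : (0 : ℝ) < Fintype.card (Fin N) := by exact_mod_cast Fintype.card_pos
  refine ⟨ε ^ 2 / (4 * Fintype.card (Fin N)), by positivity, ?_⟩
  intro f hf hlip hsum hdist φ hφ
  rw [hpS] at hdist
  have hr0 : ∀ i, 0 < lip (f i) := fun i => hε.trans_le (hlip i).1
  have hent := sum_mul_log_sub_log_neg hε hp0 hp1 hr0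
    (fun i => (hlip i).2.trans (by linarith)) hsum hdist
  have hf' := hf.toIsCompatibleSystem
  set ψ : unitInterval → ℝ := fun x => chart y (φ x) with hψ
  have hconj : ∀ i x, ψ (f i x) = p i * ψ x + chart y (S.g i 0) := fun i x => by
    simp only [hψ, ← hφ.conj]
    exact S.chart_g hN i hy (hfix i) (φ x).2
  -- a solution `φ` is not assumed to fix the end points of the interval; this follows here
  obtain ⟨hψ0, hψ1⟩ := conj_zero_one hf' hplt (i := ⟨0, by omega⟩)
    (j := ⟨N - 1, by omega⟩) rfl (by simp; omega)
    (by rw [← S.B_eq, S.B_first _ rfl, chart_zero])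
    (by
      simp only [hpdef]
      rw [S.G_coe _ hy, S.g_last _ (by simp; omega), chart_one hy]
      ring) hconj
  set C := (|y| + 1) ^ 2 / (y + 1) with hC
  have hC0 : 0 ≤ C := div_nonneg (by positivity) (by linarith)
  refine dimHMeasure_lt_one (C := C) hf'.strictMono (hf'.exists_eq (by omega)) hp0 hp1 hr0
    (fun i => (hlip i).2) (by linarith) (by linarith)
    (fun i => (hf.contraction i).abs_sub_le) hent ?_ hC0 ?_
  · have hφ0 : ((φ 0 : unitInterval) : ℝ) = 0 := by
      have h : (y + 1) * (φ 0 : ℝ) / (y * (φ 0 : ℝ) + 1) = 0 := hψ0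
      rw [div_eq_zero_iff, or_iff_left (mul_add_one_pos hy (φ 0).2).ne', mul_eq_zero] at h
      exact h.resolve_left (by linarith)
    have hφ1 : ((φ 1 : unitInterval) : ℝ) = 1 := by
      have h : (y + 1) * (φ 1 : ℝ) / (y * (φ 1 : ℝ) + 1) = 1 := hψ1
      rw [div_eq_one_iff_eq (mul_add_one_pos hy (φ 1).2).ne'] at h
      linarith
    have := hφ.μ_Icc 0 1
    rwa [hφ0, hφ1, sub_zero, ENNReal.ofReal_one] at this
  · intro n w
    have hle : φ (wordMap f w 0) ≤ φ (wordMap f w 1) :=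
      hφ.strictMono.monotone ((wordMap_strictMono hf'.strictMono w).monotone bot_le)
    rw [hφ.μ_Icc]
    refine ENNReal.ofReal_le_ofReal
      ((sub_le_mul_chart_sub hy (φ _).2 (φ _).2 hle).trans_eq ?_)
    have := conj_wordMap_sub hconj w 1 0
    rw [hψ0, hψ1, sub_zero, mul_one] at this
    rw [← this]
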